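/- Let $\mathbb N=\{1,2,3,\dots\}$, let $\mathbb N^2$ carry coordinatewise multiplication, and let $\mathbb H=\{z\in\mathbb C:\operatorname{Re} z\ge 0\}$. Let $\omega:\mathbb N^2\to[1,\infty)$ be an admissible weight, that is, $\omega(m_1m_2,n_1n_2)\le\omega(m_1,n_1)\,\omega(m_2,n_2)$ for all $(m_1,n_1),(m_2,n_2)\in\mathbb N^2$, and $\lim_{n\to\infty}\omega(l^n,k^n)^{1/n}=1$ for all $(l,k)\in\mathbb N^2$. Let $\ell^1(\mathbb N^2,\omega)$ be the unital commutative Banach algebra of all $a:\mathbb N^2\to\mathbb C$ with $\|a\|=\sum_{(m,n)\in\mathbb N^2}|a(m,n)|\,\omega(m,n)<\infty$, under the convolution $$(a\star b)(m,n)=\sum_{u_1u_2=m,\;v_1v_2=n}a(u_1,v_1)\,b(u_2,v_2),$$ and let $\mathbf A_\omega$ be the algebra, under pointwise operations, of all functions $\widetilde a:\mathbb H^2\to\mathbb C$ of the form $$\widetilde a(s_1,s_2)=\sum_{(m,n)\in\mathbb N^2}a(m,n)\,m^{-s_1}n^{-s_2}\qquad(s_1,s_2\in\mathbb H)$$ with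 $a=(a(m,n))\in\ell^1(\mathbb N^2,\omega)$. Let $\widetilde a\in\mathbf A_\omega$, with coefficients $(a(m,n))\in\ell^1(\mathbb N^2,\omega)$. Then the following statements are equivalent. (i) $(a(m,n))$ has an inverse in $\ell^1(\mathbb N^2,\omega)$. (ii) $\widetilde a$ is bounded away from zero on $\mathbb H^2$, that is, there is $k>0$ with $|\widetilde a(s_1,s_2)|\ge k$ for all $(s_1,s_2)\in\mathbb H^2$. (iii) $\widetilde a$ has an inverse in $\mathbf A_\omega$. -/

import Mathlib

open Filter Topology

/-- The multiplicative semigroup `ℕ² = {1, 2, …}²`, with coordinatewise multiplication. -/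
abbrev NSq : Type := ℕ+ × ℕ+

/-- The closed right half plane `{z ∈ ℂ : Re z ≥ 0}`. -/
abbrev ClosedRightHalfPlane : Type := {z : ℂ // 0 ≤ z.re}

/-- A weight on `ℕ²`: a submultiplicative function with values in `[1, ∞)`. -/
structure IsWeight (ω : NSq → ℝ) : Prop where
  one_le : ∀ x, 1 ≤ ω x
  mul_le : ∀ x y, ω (x * y) ≤ ω x * ω y

/-- An admissible weight: `ω(l^n, k^n)^(1/n) → 1` for every `(l, k)`. -/
structure IsAdmissibleWeight (ω : NSq → ℝ) : Prop extends IsWeight ω where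
  tendsto_one : ∀ l k : ℕ+,
    Tendsto (fun n : ℕ => ω (l ^ n, k ^ n) ^ (1 / (n : ℝ))) atTop (𝓝 1)

/-- The set `ℓ¹(ℕ², ω)` of all `a : ℕ² → ℂ` with `∑ |a(m,n)| ω(m,n) < ∞`. -/
def weightedL1 (ω : NSq → ℝ) : Set (NSq → ℂ) :=
  {a | Summable fun x => ‖a x‖ * ω x}

/-- Each element of `ℕ²` has only finitely many factorizations into two factors. -/
theorem finite_factorizations (x : NSq) : {q : NSq × NSq | q.1 * q.2 = x}.Finite := by
  have key : ∀ u v : NSq, u * v = x → u ≤ x := by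
    rintro ⟨u₁, u₂⟩ ⟨v₁, v₂⟩ rfl
    exact ⟨le_mul_of_one_le_right' (PNat.one_le v₁), le_mul_of_one_le_right' (PNat.one_le v₂)⟩
  have hfin : (Set.Iic x).Finite := by
    have : Set.Iic x = Set.Iic x.1 ×ˢ Set.Iic x.2 := by ext; simp [Prod.le_def]
    rw [this]
    have h : ∀ n : ℕ+, (Set.Iic n).Finite := fun n => by
      rw [← Set.Icc_bot]; exact Set.finite_Icc _ _
    exact (h _).prod (h _)
  refine (hfin.prod hfin).subset ?_
  rintro ⟨u, v⟩ h
  exact ⟨key u v h, key v u ((mul_comm v u).trans h)⟩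

/-- The convolution `(a ⋆ b)(m,n) = ∑ a(u₁,v₁) b(u₂,v₂)`, the sum being over all
factorizations `u₁ u₂ = m`, `v₁ v₂ = n`. -/
noncomputable def convolution (a b : NSq → ℂ) : NSq → ℂ :=
  fun x => ∑ q ∈ (finite_factorizations x).toFinset, a q.1 * b q.2

/-- The identity of the convolution: the indicator function of `(1, 1)`. -/
def convolutionOne : NSq → ℂ := fun x => if x = 1 then 1 else 0

/-- `a` has an inverse in the (commutative, unital) convolution algebra `ℓ¹(ℕ², ω)`. -/
def HasInverseInWeightedL1 (ω : NSq → ℝ) (a : NSq → ℂ) : Prop :=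
  ∃ b ∈ weightedL1 ω, convolution a b = convolutionOne

/-- `f(s₁, s₂) = ∑ a(m,n) m^(-s₁) n^(-s₂)` for all `s₁, s₂` in the closed right half plane. -/
def HasDirichletSeries (f : ClosedRightHalfPlane × ClosedRightHalfPlane → ℂ)
    (a : NSq → ℂ) : Prop :=
  ∀ s₁ s₂ : ClosedRightHalfPlane,
    HasSum (fun x : NSq => a x * (x.1 : ℂ) ^ (-(s₁ : ℂ)) * (x.2 : ℂ) ^ (-(s₂ : ℂ))) (f (s₁, s₂))

/-- The algebra `A_ω` (under pointwise operations) of all functions with an `ω`-absolutely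
convergent Dirichlet series. -/
def dirichletAlgebra (ω : NSq → ℝ) : Set (ClosedRightHalfPlane × ClosedRightHalfPlane → ℂ) :=
  {f | ∃ a ∈ weightedL1 ω, HasDirichletSeries f a}

/-- `f` has an inverse in `A_ω`, with respect to pointwise multiplication. -/
def HasInverseInDirichletAlgebra (ω : NSq → ℝ)
    (f : ClosedRightHalfPlane × ClosedRightHalfPlane → ℂ) : Prop :=
  ∃ g ∈ dirichletAlgebra ω, f * g = 1

/-- `f` is bounded away from zero. -/
def BoundedAwayFromZero (f : ClosedRightHalfPlane × ClosedRightHalfPlane → ℂ) : Prop :=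
  ∃ k : ℝ, 0 < k ∧ ∀ s, k ≤ ‖f s‖

/-! ### The convolution algebra -/

/-! The map from coefficients to functions turns convolution into pointwise product
(`hasSum_convolution`), so (i) gives (iii). Members of the algebra are bounded by the `ℓ¹` norm of
their coefficients, so (iii) gives (ii). The substance is (ii) ⇒ (i).

By Gelfand theory a noninvertible `a` is killed by a character of the Banach algebra `ℓ¹(ℕ², ω)`. On
point masses this character is a multiplicative `χ : ℕ² → ℂ` with `∑ a χ = 0`, and admissibility of
`ω` forces `|χ| ≤ 1` (`IsAdmissibleWeight.le_one_of_pow_le`). It remains to see that a lower bound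
on the half planes persists at every such `χ` (`HasDirichletSeries.le_norm_tsum`).

Truncate the series and regard the values at primes in each coordinate as independent variables: the
Dirichlet polynomial becomes an ordinary polynomial on a polydisc (`bohrLift`). Vertical lines `Re s
= σ` are dense in the torus of radii `p ^ (-σ)` by Kronecker's theorem
(`exists_forall_norm_exp_sub_lt`), so the bound holds on these tori. The minimum principle would
carry it inside, but needs nonvanishing there; this is obtained by continuously enlarging the
polydisc from the origin (`le_norm_of_forall_scaled_torus`). -/

@[simp]
theorem mem_factorizations {x : NSq} {q : NSq × NSq} :
    q ∈ (finite_factorizations x).toFinset ↔ q.1 * q.2 = x := by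
  simp

theorem convolution_comm (a b : NSq → ℂ) : convolution a b = convolution b a := by
  funext x
  refine Finset.sum_nbij' Prod.swap Prod.swap ?_ ?_ ?_ ?_ ?_
  · intro q hq
    rw [mem_factorizations] at hq ⊢
    exact (mul_comm _ _).trans hq
  · intro q hq
    rw [mem_factorizations] at hq ⊢
    exact (mul_comm _ _).trans hq
  · intro q _; rfl
  · intro q _; rfl
  · intro q _; exact mul_comm _ _

theorem convolution_assoc (a b c : NSq → ℂ) :
    convolution (convolution a b) c = convolution a (convolution b c) := by
  funext x
  simp only [convolution, Finset.sum_mul, Finset.mul_sum, Finset.sum_sigma']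
  refine Finset.sum_nbij' (fun r ↦ ⟨(r.2.1, r.2.2 * r.1.2), (r.2.2, r.1.2)⟩)
    (fun r ↦ ⟨(r.1.1 * r.2.1, r.2.2), (r.1.1, r.2.1)⟩) ?_ ?_ ?_ ?_ ?_
  · rintro ⟨⟨i, j⟩, ⟨k, l⟩⟩ h
    simp only [Finset.mem_sigma, mem_factorizations, and_true] at h ⊢
    rw [← h.1, ← h.2, mul_assoc]
  · rintro ⟨⟨i, j⟩, ⟨k, l⟩⟩ h
    simp only [Finset.mem_sigma, mem_factorizations, and_true] at h ⊢
    rw [← h.1, ← h.2, mul_assoc]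
  · rintro ⟨⟨i, j⟩, ⟨k, l⟩⟩ h
    simp only [Finset.mem_sigma, mem_factorizations] at h ⊢
    rw [h.2]
  · rintro ⟨⟨i, j⟩, ⟨k, l⟩⟩ h
    simp only [Finset.mem_sigma, mem_factorizations] at h ⊢
    rw [h.2]
  · rintro ⟨⟨i, j⟩, ⟨k, l⟩⟩ _
    exact mul_assoc _ _ _

theorem convolutionOne_convolution (a : NSq → ℂ) : convolution convolutionOne a = a := by
  funext x
  rw [convolution, Finset.sum_eq_single (1, x)]
  · simp [convolutionOne]
  · rintro ⟨u, v⟩ h hne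
    rw [mem_factorizations] at h
    have : u ≠ 1 := by
      rintro rfl
      exact hne (by rw [← h]; simp)
    simp [convolutionOne, this]
  · intro h
    exact (h (by simp)).elim

theorem convolution_add (a b c : NSq → ℂ) :
    convolution a (b + c) = convolution a b + convolution a c := by
  funext x
  simp [convolution, mul_add, Finset.sum_add_distrib]

theorem add_convolution (a b c : NSq → ℂ) :
    convolution (a + b) c = convolution a c + convolution b c := by
  rw [convolution_comm, convolution_add, convolution_comm c a, convolution_comm c b]

theorem convolution_zero (a : NSq → ℂ) : convolution a 0 = 0 := by
  funext x
  simp [convolution]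

theorem convolution_smul (r : ℂ) (a b : NSq → ℂ) :
    convolution a (r • b) = r • convolution a b := by
  funext x
  simp only [convolution, Pi.smul_apply, smul_eq_mul, Finset.mul_sum]
  exact Finset.sum_congr rfl fun q _ => by ring

theorem smul_convolution (r : ℂ) (a b : NSq → ℂ) :
    convolution (r • a) b = r • convolution a b := by
  rw [convolution_comm, convolution_smul, convolution_comm]

/-- Functions on `ℕ²`, with convolution as multiplication. -/
def ConvolutionAlgebra : Type := NSq → ℂ

namespace ConvolutionAlgebra

instance : AddCommGroup ConvolutionAlgebra := inferInstanceAs (AddCommGroup (NSq → ℂ))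

instance : Module ℂ ConvolutionAlgebra := inferInstanceAs (Module ℂ (NSq → ℂ))

noncomputable instance : CommRing ConvolutionAlgebra where
  __ := (inferInstance : AddCommGroup ConvolutionAlgebra)
  mul := convolution
  one := convolutionOne
  mul_assoc := convolution_assoc
  mul_comm := convolution_comm
  one_mul := convolutionOne_convolution
  mul_one a := (convolution_comm _ _).trans (convolutionOne_convolution a)
  left_distrib := convolution_add
  right_distrib := add_convolution
  mul_zero := convolution_zero
  zero_mul a := (convolution_comm _ _).trans (convolution_zero a)

noncomputable instance : Algebra ℂ ConvolutionAlgebra :=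
  Algebra.ofModule smul_convolution convolution_smul

/-- The underlying function of an element of the convolution algebra. -/
def coeff (a : ConvolutionAlgebra) : NSq → ℂ := a

end ConvolutionAlgebra

/-- Grouping a sum over pairs according to the product of the pair. -/
theorem hasSum_factorizations {E : Type*} [NormedAddCommGroup E] [CompleteSpace E]
    {h : NSq × NSq → E} {s : E} (hs : HasSum h s) :
    HasSum (fun x => ∑ q ∈ (finite_factorizations x).toFinset, h q) s := by
  convert hs.tsum_fiberwise fun q => q.1 * q.2 with x
  rw [← Finset.tsum_subtype]
  have : (fun q : NSq × NSq => q.1 * q.2) ⁻¹' {x} = ↑(finite_factorizations x).toFinset := by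
    ext; simp
  rw [this]
  rfl

/-- Expand the product of two absolutely convergent sums and regroup by the product of the indices;
multiplicativity makes `χ` constant on each group. -/
theorem hasSum_convolution {a b : NSq → ℂ} {χ : NSq → ℂ} (hχ : ∀ x y, χ (x * y) = χ x * χ y)
    (ha : Summable fun x => ‖a x * χ x‖) (hb : Summable fun x => ‖b x * χ x‖) :
    HasSum (fun x => convolution a b x * χ x) ((∑' x, a x * χ x) * ∑' x, b x * χ x) := by
  have h := hasSum_factorizations ((summable_mul_of_summable_norm ha hb).hasSum)
  rw [← tsum_mul_tsum_of_summable_norm ha hb] at h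
  refine (funext fun x => ?_ : (fun x => convolution a b x * χ x) = _) ▸ h
  simp only [convolution, Finset.sum_mul]
  refine Finset.sum_congr rfl fun q hq => ?_
  rw [mem_factorizations] at hq
  rw [← hq, hχ]
  ring

/-! ### The Banach algebra `ℓ¹(ℕ², ω)` -/

variable {ω : NSq → ℝ}

theorem IsWeight.summable_convolution_and_tsum_le (hω : IsWeight ω) {a b : NSq → ℂ}
    (ha : a ∈ weightedL1 ω) (hb : b ∈ weightedL1 ω) :
    convolution a b ∈ weightedL1 ω ∧
      ∑' x, ‖convolution a b x‖ * ω x ≤ (∑' x, ‖a x‖ * ω x) * ∑' x, ‖b x‖ * ω x := by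
  have hpos : ∀ x, 0 ≤ ω x := fun x => zero_le_one.trans (hω.one_le x)
  have hnn : ∀ (c : NSq → ℂ) x, 0 ≤ ‖c x‖ * ω x := fun c x => mul_nonneg (norm_nonneg _) (hpos x)
  have hs := Summable.mul_of_nonneg ha hb (hnn a) (hnn b)
  have h := hasSum_factorizations hs.hasSum
  rw [← Summable.tsum_mul_tsum ha hb hs] at h
  have hle : ∀ x, ‖convolution a b x‖ * ω x ≤
      ∑ q ∈ (finite_factorizations x).toFinset, ‖a q.1‖ * ω q.1 * (‖b q.2‖ * ω q.2) := by
    intro x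
    refine (mul_le_mul_of_nonneg_right (norm_sum_le _ _) (hpos x)).trans ?_
    rw [Finset.sum_mul]
    refine Finset.sum_le_sum fun q hq => ?_
    rw [mem_factorizations] at hq
    rw [norm_mul, mul_mul_mul_comm, ← hq]
    exact mul_le_mul_of_nonneg_left (hω.mul_le _ _) (by positivity)
  have hsum : Summable fun x => ‖convolution a b x‖ * ω x :=
    Summable.of_nonneg_of_le (hnn _) hle h.summable
  exact ⟨hsum, hasSum_le hle hsum.hasSum h⟩

theorem IsWeight.summable_norm (hω : IsWeight ω) {a : NSq → ℂ} (ha : a ∈ weightedL1 ω) :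
    Summable fun x => ‖a x‖ :=
  Summable.of_nonneg_of_le (fun _ => norm_nonneg _)
    (fun x => le_mul_of_one_le_right (norm_nonneg _) (hω.one_le x)) ha

/-- `ℓ¹(ℕ², ω)` as a subalgebra of the convolution algebra. -/
noncomputable def weightedL1Algebra (hω : IsWeight ω) : Subalgebra ℂ ConvolutionAlgebra where
  carrier := weightedL1 ω
  mul_mem' ha hb := (hω.summable_convolution_and_tsum_le ha hb).1
  add_mem' {a b} ha hb := by
    refine Summable.of_nonneg_of_le (fun x => mul_nonneg (norm_nonneg _)
      (zero_le_one.trans (hω.one_le x))) (fun x => ?_) (Summable.add ha hb)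
    rw [← add_mul]
    exact mul_le_mul_of_nonneg_right (norm_add_le (a.coeff x) (b.coeff x)) (zero_le_one.trans (hω.one_le x))
  algebraMap_mem' r := by
    refine summable_of_ne_finset_zero (s := {1}) fun x hx => ?_
    have hx : x ≠ 1 := by simpa using hx
    have : (algebraMap ℂ ConvolutionAlgebra r) x = r * convolutionOne x := by
      rw [Algebra.algebraMap_eq_smul_one]; rfl
    rw [this]
    simp [convolutionOne, hx]

namespace weightedL1Algebra

variable (hω : IsWeight ω)

/-- Multiplication by the weight maps `ℓ¹(ℕ², ω)` onto the unweighted `ℓ¹(ℕ²)`. -/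
noncomputable def toLp : weightedL1Algebra hω ≃ₗ[ℂ] lp (fun _ : NSq => ℂ) 1 where
  toFun a := ⟨fun x => a.1.coeff x * ω x, by
    refine (memℓp_gen_iff (by simp)).2 ?_
    refine (show Summable fun x => ‖a.1.coeff x‖ * ω x from a.2).congr fun x => ?_
    simp [abs_of_nonneg (zero_le_one.trans (hω.one_le x))]⟩
  invFun b := ⟨fun x => b x / ω x, by
    have hb := (memℓp_gen_iff (by simp)).1 (lp.memℓp b)
    refine hb.congr fun x => ?_
    have h0 : 0 < ω x := zero_lt_one.trans_le (hω.one_le x)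
    simp [abs_of_pos h0, div_mul_cancel₀ _ h0.ne']⟩
  map_add' a b := by
    ext x
    exact add_mul (a.1.coeff x) (b.1.coeff x) (ω x : ℂ)
  map_smul' r a := by
    ext x
    exact mul_assoc r (a.1.coeff x) (ω x : ℂ)
  left_inv a := by
    ext1
    funext x
    have h0 : (ω x : ℂ) ≠ 0 := by exact_mod_cast (zero_lt_one.trans_le (hω.one_le x)).ne'
    exact mul_div_cancel_right₀ _ h0
  right_inv b := by
    ext x
    have h0 : (ω x : ℂ) ≠ 0 := by exact_mod_cast (zero_lt_one.trans_le (hω.one_le x)).ne'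
    exact div_mul_cancel₀ _ h0

noncomputable instance : NormedAddCommGroup (weightedL1Algebra hω) :=
  NormedAddCommGroup.induced _ _ (toLp hω) (toLp hω).injective

theorem norm_eq_tsum (a : weightedL1Algebra hω) :
    ‖a‖ = ∑' x, ‖a.1.coeff x‖ * ω x := by
  change ‖toLp hω a‖ = _
  rw [lp.norm_eq_tsum_rpow (by simp)]
  simp only [ENNReal.toReal_one, Real.rpow_one, div_one]
  refine tsum_congr fun x => ?_
  change ‖a.1.coeff x * ω x‖ = _
  simp [abs_of_nonneg (zero_le_one.trans (hω.one_le x))]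

noncomputable instance : NormedCommRing (weightedL1Algebra hω) where
  __ := (inferInstance : NormedAddCommGroup (weightedL1Algebra hω))
  __ := (inferInstance : CommRing (weightedL1Algebra hω))
  norm_mul_le a b := by
    change ‖a * b‖ ≤ ‖a‖ * ‖b‖
    simp only [norm_eq_tsum]
    exact (hω.summable_convolution_and_tsum_le a.2 b.2).2

noncomputable instance : NormedAlgebra ℂ (weightedL1Algebra hω) where
  __ := (inferInstance : Algebra ℂ (weightedL1Algebra hω))
  norm_smul_le r a := by
    change ‖toLp hω (r • a)‖ ≤ ‖r‖ * ‖toLp hω a‖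
    rw [map_smul, norm_smul]

/-- The isometry between `ℓ¹(ℕ², ω)` and `ℓ¹(ℕ²)`. -/
noncomputable def toLpIsometry : weightedL1Algebra hω ≃ₗᵢ[ℂ] lp (fun _ : NSq => ℂ) 1 where
  __ := toLp hω
  norm_map' _ := rfl

instance : CompleteSpace (weightedL1Algebra hω) :=
  (completeSpace_congr (e := (toLpIsometry hω).toEquiv) (toLpIsometry hω).isometry.isUniformEmbedding).2 inferInstance

/-- The indicator function of a point. -/
noncomputable def single (x : NSq) : weightedL1Algebra hω :=
  ⟨(Pi.single x 1 : NSq → ℂ), summable_of_ne_finset_zero (s := {x}) fun y hy => by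
    have : y ≠ x := by simpa using hy
    simp [this]⟩

theorem single_one : single hω 1 = 1 := by
  ext1
  funext x
  change (Pi.single 1 1 : NSq → ℂ) x = convolutionOne x
  simp [Pi.single_apply, convolutionOne]

theorem single_mul (x y : NSq) : single hω (x * y) = single hω x * single hω y := by
  ext1
  funext z
  change (Pi.single (x * y) 1 : NSq → ℂ) z = convolution (Pi.single x 1) (Pi.single y 1) z
  rw [convolution]
  have : ∀ q : NSq × NSq, (Pi.single x 1 : NSq → ℂ) q.1 * (Pi.single y 1 : NSq → ℂ) q.2 =
      if (x, y) = q then 1 else 0 := by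
    rintro ⟨u, v⟩
    simp only [Pi.single_apply, Prod.mk.injEq]
    split_ifs <;> simp_all
  rw [Finset.sum_congr rfl fun q _ => this q, Finset.sum_ite_eq, Pi.single_apply]
  simp only [mem_factorizations, eq_comm (a := z)]

theorem norm_single (x : NSq) : ‖single hω x‖ = ω x := by
  rw [norm_eq_tsum, tsum_eq_single x]
  · change ‖(Pi.single x 1 : NSq → ℂ) x‖ * ω x = _
    simp
  · intro y hy
    change ‖(Pi.single x 1 : NSq → ℂ) y‖ * ω y = _
    simp [hy]

/-- Transported from the corresponding expansion in `lp`. It makes a continuous character computable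
from its values on point masses. -/
theorem hasSum_single (a : weightedL1Algebra hω) :
    HasSum (fun x => a.1.coeff x • single hω x) a := by
  have h := (lp.hasSum_single ENNReal.one_ne_top (toLpIsometry hω a)).map
    (toLpIsometry hω).symm (toLpIsometry hω).symm.continuous
  rw [LinearIsometryEquiv.symm_apply_apply] at h
  convert h with x
  rw [Function.comp_apply, eq_comm, LinearIsometryEquiv.symm_apply_eq]
  ext y
  change (Pi.single x (a.1.coeff x * ω x) : NSq → ℂ) y =
    a.1.coeff x * (Pi.single x 1 : NSq → ℂ) y * ω y
  rcases eq_or_ne y x with rfl | hy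
  · simp
  · simp [hy]

end weightedL1Algebra

/-! ### Minimum modulus on a polydisc -/

section Polydisc

variable {ι : Type*} [Fintype ι]

/-- A nonvanishing holomorphic function on the closed unit disc attains its minimum modulus on
the circle. -/
theorem le_norm_of_forall_norm_eq_one {g : ℂ → ℂ} (hg : Differentiable ℂ g)
    (h0 : ∀ z, ‖z‖ ≤ 1 → g z ≠ 0) {k : ℝ} (hk : 0 < k) (hb : ∀ z, ‖z‖ = 1 → k ≤ ‖g z‖)
    {z : ℂ} (hz : ‖z‖ ≤ 1) : k ≤ ‖g z‖ := by
  have hcl : closure (Metric.ball (0 : ℂ) 1) = Metric.closedBall 0 1 :=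
    closure_ball _ one_ne_zero
  have hd : DiffContOnCl ℂ (fun w => (g w)⁻¹) (Metric.ball 0 1) := by
    refine DifferentiableOn.diffContOnCl ?_
    rw [hcl]
    intro w hw
    exact ((hg w).inv (h0 w (by simpa using hw))).differentiableWithinAt
  have := Complex.norm_le_of_forall_mem_frontier_norm_le Metric.isBounded_ball hd (C := k⁻¹)
    (fun w hw => by
      rw [frontier_ball _ one_ne_zero] at hw
      rw [norm_inv]
      exact inv_anti₀ hk (hb w (by simpa using hw)))
    (z := z) (by rw [hcl]; simpa using hz)
  rw [norm_inv] at this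
  exact (inv_le_inv₀ (norm_pos_iff.2 (h0 z hz)) hk).1 this

/-- A nonvanishing holomorphic function on the closed unit polydisc attains its minimum modulus
on the torus. -/
theorem le_norm_of_forall_torus {F : (ι → ℂ) → ℂ} (hF : Differentiable ℂ F)
    (h0 : ∀ z : ι → ℂ, (∀ i, ‖z i‖ ≤ 1) → F z ≠ 0) {k : ℝ} (hk : 0 < k)
    (hb : ∀ z : ι → ℂ, (∀ i, ‖z i‖ = 1) → k ≤ ‖F z‖)
    {z : ι → ℂ} (hz : ∀ i, ‖z i‖ ≤ 1) : k ≤ ‖F z‖ := by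
  classical
  -- Release the coordinates from the circle one at a time, applying the one-variable case to each;
  -- `s` holds those already released.
  have key : ∀ s : Finset ι, ∀ z : ι → ℂ, (∀ i, ‖z i‖ ≤ 1) → (∀ i ∉ s, ‖z i‖ = 1) →
      k ≤ ‖F z‖ := by
    intro s
    induction s using Finset.induction_on with
    | empty => exact fun z _ h => hb z fun i => h i (by simp)
    | insert j s hj ih =>
      intro z hz h
      have hle : ∀ w : ℂ, ‖w‖ ≤ 1 → ∀ i, ‖Function.update z j w i‖ ≤ 1 := by
        intro w hw i
        rcases eq_or_ne i j with rfl | hi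
        · simpa using hw
        · simpa [hi] using hz i
      have := le_norm_of_forall_norm_eq_one (g := fun w => F (Function.update z j w))
        (hF.comp fun w => (hasFDerivAt_update z w).differentiableAt)
        (fun w hw => h0 _ (hle w hw)) hk (fun w hw => ih _ (hle w hw.le) fun i hi => by
          rcases eq_or_ne i j with rfl | hij
          · simpa using hw
          · simpa [hij] using h i (by simp [hij, hi])) (hz j)
      simpa using this
  exact key Finset.univ z hz (by simp)

/-- If an entire function is bounded below on the tori of radii `ρ ^ c i`, for all `ρ ∈ (0, 1]`,
then it is bounded below on the unit polydisc. -/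
theorem le_norm_of_forall_scaled_torus {F : (ι → ℂ) → ℂ} (hF : Differentiable ℂ F)
    {c : ι → ℝ} (hc : ∀ i, 0 < c i) {k : ℝ} (hk : 0 < k)
    (hb : ∀ ρ : ℝ, 0 < ρ → ρ ≤ 1 → ∀ z : ι → ℂ, (∀ i, ‖z i‖ = 1) →
      k ≤ ‖F fun i => ((ρ ^ c i : ℝ) : ℂ) * z i‖)
    {z : ι → ℂ} (hz : ∀ i, ‖z i‖ ≤ 1) : k ≤ ‖F z‖ := by
  have hcont : Continuous fun q : ℝ × (ι → ℂ) => ‖F fun i => ((q.1 ^ c i : ℝ) : ℂ) * q.2 i‖ := by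
    refine (hF.continuous.comp (continuous_pi fun i => ?_)).norm
    exact (Complex.continuous_ofReal.comp
      ((Real.continuous_rpow_const (hc i).le).comp continuous_fst)).mul
      ((continuous_apply i).comp continuous_snd)
  let D : Set (ι → ℂ) := Set.univ.pi fun _ => Metric.closedBall 0 1
  have hD : IsCompact D := isCompact_univ_pi fun _ => isCompact_closedBall _ _
  have hmem : ∀ w : ι → ℂ, w ∈ D ↔ ∀ i, ‖w i‖ ≤ 1 := fun w => by simp [D]
  -- Continuity method: `T` is closed, contains `0`, and can be extended to the right of each of its
  -- points in `[0, 1)`, hence contains `1`.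
  let T : Set ℝ := {ρ | ∀ w ∈ D, k ≤ ‖F fun i => ((ρ ^ c i : ℝ) : ℂ) * w i‖}
  have hT : IsClosed T := by
    have : T = ⋂ w ∈ D, {ρ | k ≤ ‖F fun i => ((ρ ^ c i : ℝ) : ℂ) * w i‖} := by
      ext; simp [T]
    rw [this]
    exact isClosed_biInter fun w _ => isClosed_le continuous_const
      (hcont.comp (continuous_id.prodMk continuous_const))
  -- Since each `c i` is positive, the scaled polydisc collapses to the origin at `ρ = 0`, and the
  -- bound there is a limit of bounds on small tori.
  have h0 : (0 : ℝ) ∈ T := by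
    intro w _
    have hlim : Tendsto (fun ρ : ℝ => ‖F fun i => ((ρ ^ c i : ℝ) : ℂ) * (1 : ι → ℂ) i‖)
        (𝓝[>] 0) (𝓝 ‖F fun i => (((0 : ℝ) ^ c i : ℝ) : ℂ) * (1 : ι → ℂ) i‖) :=
      ((hcont.comp (continuous_id.prodMk continuous_const)).tendsto 0).mono_left
        nhdsWithin_le_nhds
    have := ge_of_tendsto hlim (by
      filter_upwards [Ioc_mem_nhdsGT (zero_lt_one' ℝ)] with ρ hρ
      exact hb ρ hρ.1 hρ.2 _ (by simp))
    simpa [Real.zero_rpow (hc _).ne'] using this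
  have hopen : ∀ ρ ∈ T ∩ Set.Ico 0 1, T ∈ 𝓝[>] ρ := by
    rintro ρ ⟨hρ, hρ0, hρ1⟩
    -- Compactness keeps `F` nonvanishing on slightly larger polydiscs; the torus bound then
    -- restores the full constant `k`, so nothing is lost as `ρ` grows.
    have hev := hD.eventually_forall_of_forall_eventually (x₀ := ρ)
      (P := fun σ w => 0 < ‖F fun i => ((σ ^ c i : ℝ) : ℂ) * w i‖)
      (fun w hw => hcont.continuousAt.eventually_const_lt (hk.trans_le (hρ w hw)))
    filter_upwards [nhdsWithin_le_nhds hev, Ioc_mem_nhdsGT hρ1] with σ hσ hσ1 w hw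
    refine le_norm_of_forall_torus (F := fun w => F fun i => ((σ ^ c i : ℝ) : ℂ) * w i)
      (hF.comp ?_) (fun w hw => norm_pos_iff.1 (hσ w ((hmem w).2 hw))) hk
      (hb σ (hρ0.trans_lt hσ1.1) hσ1.2) ((hmem w).1 hw)
    fun_prop
  have h1 : (1 : ℝ) ∈ T :=
    (hT.inter isClosed_Icc).Icc_subset_of_forall_mem_nhdsWithin h0 hopen ⟨zero_le_one, le_rfl⟩
  simpa using h1 z ((hmem z).2 hz)

end Polydisc

/-! ### Kronecker's theorem for the logarithms of primes -/

/-- The primitive of a nonconstant unimodular exponential is bounded, so its average decays like `1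
/ T`. -/
theorem tendsto_average_exp_mul_I {c : ℝ} (hc : c ≠ 0) :
    Tendsto (fun T : ℝ => (T : ℂ)⁻¹ * ∫ t in (0 : ℝ)..T, Complex.exp (c * Complex.I * t))
      atTop (𝓝 0) := by
  have hcI : (c : ℂ) * Complex.I ≠ 0 := by simp [hc]
  simp only [integral_exp_mul_complex hcI]
  refine squeeze_zero_norm' (a := fun T : ℝ => T⁻¹ * (2 / |c|)) ?_ ?_
  · filter_upwards [eventually_gt_atTop 0] with T hT
    have h1 : ‖Complex.exp (c * Complex.I * T) - Complex.exp (c * Complex.I * (0 : ℝ))‖ ≤ 2 := by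
      refine (norm_sub_le _ _).trans ?_
      have h2 : ‖Complex.exp (c * Complex.I * T)‖ = 1 := by
        rw [mul_right_comm, ← Complex.ofReal_mul, Complex.norm_exp_ofReal_mul_I]
      rw [h2]
      norm_num
    rw [norm_mul, norm_div, norm_inv, Complex.norm_real, Real.norm_of_nonneg hT.le]
    have h3 : ‖(c : ℂ) * Complex.I‖ = |c| := by simp
    rw [h3]
    gcongr
  · simpa using tendsto_inv_atTop_zero.mul_const (2 / |c|)

/-- The mean value of an exponential sum along the positive half line is the coefficient of the
frequency zero. -/
theorem tendsto_average_exponential_sum {κ : Type*} (s : Finset κ) (d : κ → ℂ) (l : κ → ℝ)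
    {j : κ} (hj : j ∈ s) (hl : l j = 0) (hne : ∀ i ∈ s, i ≠ j → l i ≠ 0) :
    Tendsto (fun T : ℝ => (T : ℂ)⁻¹ *
      ∫ t in (0 : ℝ)..T, ∑ i ∈ s, d i * Complex.exp (l i * Complex.I * t)) atTop (𝓝 (d j)) := by
  classical
  have hint : ∀ T : ℝ, (T : ℂ)⁻¹ *
      ∫ t in (0 : ℝ)..T, ∑ i ∈ s, d i * Complex.exp (l i * Complex.I * t) =
      ∑ i ∈ s, d i * ((T : ℂ)⁻¹ * ∫ t in (0 : ℝ)..T, Complex.exp (l i * Complex.I * t)) := by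
    intro T
    rw [intervalIntegral.integral_finsetSum, Finset.mul_sum]
    · refine Finset.sum_congr rfl fun i _ => ?_
      rw [intervalIntegral.integral_const_mul]
      ring
    · intro i _
      exact Continuous.intervalIntegrable (by fun_prop) _ _
  simp only [hint]
  have hlim : d j = ∑ i ∈ s, d i * (if i = j then 1 else 0) := by simp [hj]
  rw [hlim]
  refine tendsto_finsetSum _ fun i hi => Tendsto.const_mul _ ?_
  split_ifs with hij
  · subst hij
    refine tendsto_const_nhds.congr' ?_
    filter_upwards [eventually_gt_atTop 0] with T hT
    have : (T : ℂ) ≠ 0 := by exact_mod_cast hT.ne'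
    simp [hl, this]
  · exact tendsto_average_exp_mul_I (hne i hi hij)

theorem le_of_exponential_sum_le {κ : Type*} (s : Finset κ) (d : κ → ℂ) (l : κ → ℝ)
    {j : κ} (hj : j ∈ s) (hl : l j = 0) (hne : ∀ i ∈ s, i ≠ j → l i ≠ 0) {B : ℝ}
    (hB : ∀ t : ℝ, ‖∑ i ∈ s, d i * Complex.exp (l i * Complex.I * t)‖ ≤ B) : ‖d j‖ ≤ B := by
  refine le_of_tendsto (tendsto_average_exponential_sum s d l hj hl hne).norm ?_
  filter_upwards [eventually_gt_atTop 0] with T hT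
  rw [norm_mul, norm_inv, Complex.norm_real, Real.norm_of_nonneg hT.le]
  have := intervalIntegral.norm_integral_le_of_norm_le_const (a := 0) (b := T) (C := B)
    (f := fun t : ℝ => ∑ i ∈ s, d i * Complex.exp (l i * Complex.I * t)) fun t _ => hB t
  rw [sub_zero, abs_of_pos hT] at this
  rw [inv_mul_le_iff₀ hT, mul_comm T]
  exact this

theorem one_add_pow_eq_sum (w : ℂ) (N : ℕ) :
    (1 + w) ^ (2 * N) = ∑ m ∈ Finset.range (2 * N + 1), ((2 * N).choose m : ℂ) * w ^ m := by
  rw [add_comm, add_pow]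
  exact Finset.sum_congr rfl fun m _ => by simp [mul_comm]

/-- Kronecker's theorem: the flow with frequencies linearly independent over `ℤ` is dense in the
torus. -/
theorem exists_forall_norm_exp_sub_lt {ι : Type*} [Fintype ι] (l : ι → ℝ)
    (hl : ∀ m : ι → ℤ, ∑ i, m i * l i = 0 → m = 0) (θ : ι → ℂ) (hθ : ∀ i, ‖θ i‖ = 1)
    {ε : ℝ} (hε : 0 < ε) :
    ∃ t : ℝ, ∀ i, ‖Complex.exp (l i * Complex.I * t) - θ i‖ < ε := by
  classical
  by_contra! hcon
  have hexp : ∀ i (t : ℝ), ‖Complex.exp (l i * Complex.I * t)‖ = 1 := fun i t => by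
    rw [mul_right_comm, ← Complex.ofReal_mul, Complex.norm_exp_ofReal_mul_I]
  have hθ0 : ∀ i, θ i ≠ 0 := fun i h => by simpa [h] using hθ i
  -- the parallelogram law bounds the kernel `∏ (1 + (θ i)⁻¹ w i) ^ (2 * N)` away from `w = θ`
  have hpar : ∀ w z : ℂ, ‖w‖ = 1 → ‖z‖ = 1 → ‖z + w‖ ^ 2 = 4 - ‖w - z‖ ^ 2 := by
    intro w z hw hz
    have := parallelogram_law_with_norm ℝ w z
    rw [hw, hz] at this
    rw [add_comm]
    nlinarith
  -- The maximum with `0` covers `ε > 2`, where `1 - ε ^ 2 / 4` is negative.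
  set δ : ℝ := max (1 - ε ^ 2 / 4) 0 with hδ
  have hδ0 : 0 ≤ δ := le_max_right _ _
  have hδ1 : δ < 1 := max_lt (by nlinarith [pow_pos hε 2]) one_pos
  set n := Fintype.card ι with hn
  have hle : ∀ N : ℕ, 1 ≤ ((2 * N + 1 : ℕ) : ℝ) ^ n * δ ^ N := by
    intro N
    let κ := ι → ℕ
    let s : Finset κ := Fintype.piFinset fun _ => Finset.range (2 * N + 1)
    let d : κ → ℂ := fun m => ∏ i, ((2 * N).choose (m i) : ℂ) * (θ i)⁻¹ ^ m i
    -- The shift by `N` puts the central, largest coefficient of the kernel at frequency zero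
    -- without changing the modulus of the sum.
    let fr : κ → ℝ := fun m => ∑ i, ((m i : ℝ) - N) * l i
    have hsum : ∀ t : ℝ, ∑ m ∈ s, d m * Complex.exp (fr m * Complex.I * t) =
        (∏ i, Complex.exp (-(N * l i) * Complex.I * t)) *
          ∏ i, (1 + (θ i)⁻¹ * Complex.exp (l i * Complex.I * t)) ^ (2 * N) := by
      intro t
      simp only [one_add_pow_eq_sum]
      rw [Finset.prod_univ_sum, Finset.mul_sum]
      refine Finset.sum_congr rfl fun m _ => ?_
      have : Complex.exp (fr m * Complex.I * t) =
          ∏ i, (Complex.exp (-(N * l i) * Complex.I * t) *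
            Complex.exp (l i * Complex.I * t) ^ m i) := by
        simp only [← Complex.exp_nat_mul, ← Complex.exp_add]
        rw [← Complex.exp_sum]
        congr 1
        simp only [fr]
        push_cast
        rw [Finset.sum_mul, Finset.sum_mul]
        exact Finset.sum_congr rfl fun i _ => by ring
      rw [this]
      simp only [d]
      rw [← Finset.prod_mul_distrib, ← Finset.prod_mul_distrib]
      exact Finset.prod_congr rfl fun i _ => by rw [mul_pow]; ring
    have hbound : ∀ t : ℝ, ‖∑ m ∈ s, d m * Complex.exp (fr m * Complex.I * t)‖ ≤
        (4 ^ N) ^ n * δ ^ N := by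
      intro t
      rw [hsum, norm_mul, norm_prod, norm_prod]
      have h1 : ∏ i, ‖Complex.exp (-(N * l i) * Complex.I * t)‖ = 1 := by
        refine Finset.prod_eq_one fun i _ => ?_
        have : (-(N * l i) * Complex.I * t : ℂ) = ((-(N * l i) * t : ℝ) : ℂ) * Complex.I := by
          push_cast; ring
        rw [this, Complex.norm_exp_ofReal_mul_I]
      rw [h1, one_mul]
      have h2 : ∀ i, ‖(1 + (θ i)⁻¹ * Complex.exp (l i * Complex.I * t)) ^ (2 * N)‖ =
          (4 - ‖Complex.exp (l i * Complex.I * t) - θ i‖ ^ 2) ^ N := by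
        intro i
        rw [norm_pow, pow_mul, ← hpar _ _ (hexp i t) (hθ i)]
        congr 2
        have : 1 + (θ i)⁻¹ * Complex.exp (l i * Complex.I * t) =
            (θ i)⁻¹ * (θ i + Complex.exp (l i * Complex.I * t)) := by
          rw [mul_add, inv_mul_cancel₀ (hθ0 i)]
        rw [this, norm_mul, norm_inv, hθ i, inv_one, one_mul]
      simp only [h2]
      have h3 : ∀ i, 0 ≤ 4 - ‖Complex.exp (l i * Complex.I * t) - θ i‖ ^ 2 := fun i => by
        rw [← hpar _ _ (hexp i t) (hθ i)]; positivity
      -- At each time some coordinate is at least `ε` from its target. Its factor is at most `4 *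
      -- δ`, and every other factor is at most `4`.
      obtain ⟨j, hj⟩ := hcon t
      rw [Finset.prod_pow, ← pow_mul, mul_comm N n, pow_mul, ← mul_pow]
      refine pow_le_pow_left₀ (Finset.prod_nonneg fun i _ => h3 i) ?_ N
      rw [← Finset.mul_prod_erase Finset.univ _ (Finset.mem_univ j)]
      have h4 : 4 - ‖Complex.exp (l j * Complex.I * t) - θ j‖ ^ 2 ≤ 4 * δ := by
        have : ε ^ 2 ≤ ‖Complex.exp (l j * Complex.I * t) - θ j‖ ^ 2 :=
          pow_le_pow_left₀ hε.le hj 2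
        have := le_max_left (1 - ε ^ 2 / 4) 0
        linarith
      have h5 : ∏ i ∈ Finset.univ.erase j, (4 - ‖Complex.exp (l i * Complex.I * t) - θ i‖ ^ 2) ≤
          4 ^ (n - 1) := by
        refine (Finset.prod_le_prod (g := fun _ => 4) (fun i _ => h3 i) fun i _ => ?_).trans_eq ?_
        · linarith [sq_nonneg ‖Complex.exp (l i * Complex.I * t) - θ i‖]
        · rw [Finset.prod_const, Finset.card_erase_of_mem (Finset.mem_univ j), Finset.card_univ]
      have hn1 : n = n - 1 + 1 := (Nat.sub_add_cancel (Fintype.card_pos_iff.2 ⟨j⟩)).symm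
      calc _ ≤ 4 * δ * 4 ^ (n - 1) :=
            mul_le_mul h4 h5 (Finset.prod_nonneg fun i _ => h3 i) (by positivity)
        _ = 4 ^ n * δ := by
            conv_rhs => rw [hn1, pow_succ]
            ring
    -- Independence leaves the constant multi-index `N` as the only one of frequency zero. Its
    -- coefficient has modulus `(2 * N).choose N ^ n`, only polynomially smaller than `4 ^ (N * n)`.
    have hmean := le_of_exponential_sum_le s d fr (j := fun _ => N)
      (Fintype.mem_piFinset.2 fun _ => Finset.mem_range.2 (by omega)) (by simp [fr])
      (fun m _ hm h0 => hm (by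
        have := hl (fun i => (m i : ℤ) - N) (by push_cast; exact h0)
        funext i
        have hi := congrFun this i
        simp only [Pi.zero_apply] at hi
        omega)) hbound
    have hd : ‖d fun _ => N‖ = ((2 * N).choose N : ℝ) ^ n := by
      simp [d, hθ, hn]
    rw [hd] at hmean
    have hcb : (4 : ℝ) ^ N ≤ ((2 * N + 1 : ℕ) : ℝ) * ((2 * N).choose N : ℝ) := by
      exact_mod_cast Nat.four_pow_le_two_mul_add_one_mul_central_binom N
    have h6 : ((4 : ℝ) ^ N) ^ n ≤ ((2 * N + 1 : ℕ) : ℝ) ^ n * ((4 ^ N) ^ n * δ ^ N) := by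
      refine (pow_le_pow_left₀ (by positivity) hcb n).trans ?_
      rw [mul_pow]
      exact mul_le_mul_of_nonneg_left hmean (by positivity)
    have h7 : (0 : ℝ) < (4 ^ N) ^ n := by positivity
    refine le_of_mul_le_mul_left ?_ h7
    linarith
  -- Geometric decay beats polynomial growth, contradicting `hle`; the `3` comes from `2 * N + 1 ≤ 3
  -- * N` for `N ≥ 1`.
  have hlim : Tendsto (fun N : ℕ => (3 : ℝ) ^ n * ((N : ℝ) ^ n * δ ^ N)) atTop (𝓝 0) := by
    simpa using (tendsto_pow_const_mul_const_pow_of_abs_lt_one n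
      (by rwa [abs_of_nonneg hδ0])).const_mul ((3 : ℝ) ^ n)
  refine absurd (ge_of_tendsto hlim ?_) (not_le.2 one_pos)
  filter_upwards [eventually_ge_atTop 1] with N hN
  refine (hle N).trans ?_
  rw [← mul_assoc, ← mul_pow]
  gcongr
  have : (2 * N + 1 : ℕ) ≤ 3 * N := by omega
  exact_mod_cast this

theorem factorization_prod_prime_pow {B : Finset ℕ} (hB : ∀ p ∈ B, p.Prime) (e : B → ℕ) (q : B) :
    (∏ p : B, (p : ℕ) ^ e p).factorization q = e q := by
  classical
  rw [Nat.factorization_prod fun (p : B) _ => pow_ne_zero _ (hB p p.2).ne_zero, Finset.sum_apply']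
  rw [Finset.sum_eq_single q]
  · rw [(hB q q.2).factorization_pow, Finsupp.single_eq_same]
  · intro p _ hpq
    rw [(hB p p.2).factorization_pow, Finsupp.single_eq_of_ne fun h => hpq (Subtype.ext h.symm)]
  · simp

/-- The logarithms of distinct primes are linearly independent over `ℤ`. -/
theorem eq_zero_of_sum_mul_log_prime_eq_zero {B : Finset ℕ} (hB : ∀ p ∈ B, p.Prime) (m : B → ℤ)
    (h : ∑ p, m p * Real.log (p : ℕ) = 0) : m = 0 := by
  have hlog : ∀ e : B → ℕ, Real.log ((∏ p : B, (p : ℕ) ^ e p : ℕ) : ℝ) =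
      ∑ p, e p * Real.log (p : ℕ) := by
    intro e
    push_cast
    rw [Real.log_prod fun p _ => pow_ne_zero _ (by exact_mod_cast (hB p p.2).ne_zero)]
    exact Finset.sum_congr rfl fun p _ => Real.log_pow _ _
  have hpos : ∀ e : B → ℕ, (0 : ℝ) < ((∏ p : B, (p : ℕ) ^ e p : ℕ) : ℝ) := fun e => by
    exact_mod_cast Finset.prod_pos fun (p : B) _ => pow_pos (hB p p.2).pos _
  -- Moving the negative exponents to the other side gives two natural numbers with equal
  -- logarithms; unique factorization then applies.
  have heq : ∏ p : B, (p : ℕ) ^ (m p).toNat = ∏ p : B, (p : ℕ) ^ (-m p).toNat := by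
    have : Real.log ((∏ p : B, (p : ℕ) ^ (m p).toNat : ℕ) : ℝ) =
        Real.log ((∏ p : B, (p : ℕ) ^ (-m p).toNat : ℕ) : ℝ) := by
      rw [hlog, hlog, ← sub_eq_zero, ← Finset.sum_sub_distrib, ← h]
      refine Finset.sum_congr rfl fun p _ => ?_
      rw [← sub_mul]
      congr 1
      exact_mod_cast Int.toNat_sub_toNat_neg (m p)
    exact_mod_cast Real.log_injOn_pos (hpos _) (hpos _) this
  funext q
  have hq := factorization_prod_prime_pow hB (fun p => (m p).toNat) q
  rw [heq, factorization_prod_prime_pow hB (fun p => (-m p).toNat) q] at hq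
  simp only [Pi.zero_apply]
  omega

theorem prime_torus_subset_closure {B : Finset ℕ} (hB : ∀ p ∈ B, p.Prime) {θ : B → ℂ}
    (hθ : ∀ p, ‖θ p‖ = 1) :
    θ ∈ closure (Set.range fun (t : ℝ) (p : B) => ((p : ℕ) : ℂ) ^ (-(t * Complex.I))) := by
  rw [Metric.mem_closure_range_iff]
  intro ε hε
  obtain ⟨t, ht⟩ := exists_forall_norm_exp_sub_lt (fun p : B => Real.log (p : ℕ))
    (eq_zero_of_sum_mul_log_prime_eq_zero hB) θ hθ hε
  refine ⟨-t, ?_⟩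
  rw [dist_comm, dist_pi_lt_iff hε]
  intro p
  have hp : ((p : ℕ) : ℂ) ≠ 0 := by exact_mod_cast (hB p p.2).ne_zero
  have : ((p : ℕ) : ℂ) ^ (-(((-t : ℝ) : ℂ) * Complex.I)) =
      Complex.exp (Real.log (p : ℕ) * Complex.I * t) := by
    rw [Complex.cpow_def_of_ne_zero hp, Complex.natCast_log]
    congr 1
    push_cast
    ring
  rw [dist_eq_norm, this]
  exact ht p

/-! ### Dirichlet series and characters -/

/-- The completely multiplicative function `m ↦ m ^ (-s)`. -/
noncomputable def dirichletHom (s : ℂ) : ℕ+ →* ℂ where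
  toFun m := (m : ℂ) ^ (-s)
  map_one' := by simp
  map_mul' m n := by
    rw [PNat.mul_coe, Nat.cast_mul, Complex.natCast_mul_natCast_cpow]

theorem dirichletHom_apply (s : ℂ) (m : ℕ+) : dirichletHom s m = (m : ℂ) ^ (-s) := rfl

theorem norm_dirichletHom_le {s : ℂ} (hs : 0 ≤ s.re) (m : ℕ+) : ‖dirichletHom s m‖ ≤ 1 := by
  rw [dirichletHom_apply, Complex.norm_natCast_cpow_of_pos m.pos]
  exact Real.rpow_le_one_of_one_le_of_nonpos (by exact_mod_cast m.pos) (by simpa using hs)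

theorem norm_mul_dirichletHom_le (a : NSq → ℂ) {s₁ s₂ : ℂ} (h₁ : 0 ≤ s₁.re) (h₂ : 0 ≤ s₂.re)
    (x : NSq) : ‖a x * (dirichletHom s₁ x.1 * dirichletHom s₂ x.2)‖ ≤ ‖a x‖ := by
  rw [norm_mul, norm_mul]
  exact mul_le_of_le_one_right (norm_nonneg _) (mul_le_one₀ (norm_dirichletHom_le h₁ _)
    (norm_nonneg _) (norm_dirichletHom_le h₂ _))

theorem HasDirichletSeries.hasSum {f : ClosedRightHalfPlane × ClosedRightHalfPlane → ℂ}
    {a : NSq → ℂ} (hf : HasDirichletSeries f a) (s : ClosedRightHalfPlane × ClosedRightHalfPlane) :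
    HasSum (fun x : NSq => a x * (dirichletHom s.1 x.1 * dirichletHom s.2 x.2)) (f s) := by
  simpa only [dirichletHom_apply, mul_assoc] using hf s.1 s.2

section Primes

variable {B : Finset ℕ} (hB : ∀ p ∈ B, p.Prime)

/-- A prime of the finite set `B`, as a positive natural number. -/
def primeToPNat (p : B) : ℕ+ := ⟨p, (hB p p.2).pos⟩

theorem MonoidHom.apply_eq_prod_primes (ψ : ℕ+ →* ℂ) {m : ℕ+} (hm : (m : ℕ).primeFactors ⊆ B) :
    ψ m = ∏ p : B, ψ (primeToPNat hB p) ^ (m : ℕ).factorization p := by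
  have h : m = ∏ p : B, primeToPNat hB p ^ (m : ℕ).factorization p := by
    refine PNat.eq ?_
    rw [← PNat.coe_coeMonoidHom, map_prod]
    simp only [map_pow, PNat.coe_coeMonoidHom]
    change (m : ℕ) = ∏ p : B, (p : ℕ) ^ (m : ℕ).factorization p
    rw [Finset.prod_coe_sort B fun p => p ^ (m : ℕ).factorization p]
    conv_lhs => rw [← Nat.prod_factorization_pow_eq_self m.ne_zero]
    exact Finsupp.prod_of_support_subset _ hm _ (by simp)
  conv_lhs => rw [h]
  simp only [map_prod, map_pow]

/-- The polynomial in the variables indexed by two copies of `B` that lifts the Dirichlet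
polynomial with coefficients `a` on `S`. -/
noncomputable def bohrLift (a : NSq → ℂ) (S : Finset NSq) (B : Finset ℕ) (z : B ⊕ B → ℂ) : ℂ :=
  ∑ x ∈ S, a x * ((∏ p : B, z (.inl p) ^ (x.1 : ℕ).factorization p) *
    ∏ p : B, z (.inr p) ^ (x.2 : ℕ).factorization p)

theorem differentiable_bohrLift (a : NSq → ℂ) (S : Finset NSq) (B : Finset ℕ) :
    Differentiable ℂ (bohrLift a S B) := by
  unfold bohrLift
  fun_prop

/-- Multiplicative functions are determined by their values at primes, so Dirichlet characters and
arbitrary characters are both points at which the same polynomial is evaluated. -/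
theorem bohrLift_apply (a : NSq → ℂ) {S : Finset NSq}
    (hS : ∀ x ∈ S, (x.1 : ℕ).primeFactors ⊆ B ∧ (x.2 : ℕ).primeFactors ⊆ B) (ψ₁ ψ₂ : ℕ+ →* ℂ) :
    bohrLift a S B (Sum.elim (fun p => ψ₁ (primeToPNat hB p)) fun p => ψ₂ (primeToPNat hB p)) =
      ∑ x ∈ S, a x * (ψ₁ x.1 * ψ₂ x.2) := by
  refine Finset.sum_congr rfl fun x hx => ?_
  rw [ψ₁.apply_eq_prod_primes hB (hS x hx).1, ψ₂.apply_eq_prod_primes hB (hS x hx).2]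
  rfl

/-- A lower bound for a Dirichlet polynomial on the product of half planes is a lower bound for
its lift on the polydisc. -/
theorem le_norm_bohrLift (hB : ∀ p ∈ B, p.Prime) {a : NSq → ℂ} {S : Finset NSq}
    (hS : ∀ x ∈ S, (x.1 : ℕ).primeFactors ⊆ B ∧ (x.2 : ℕ).primeFactors ⊆ B) {k : ℝ} (hk : 0 < k)
    (h : ∀ s₁ s₂ : ℂ, 0 ≤ s₁.re → 0 ≤ s₂.re →
      k ≤ ‖∑ x ∈ S, a x * (dirichletHom s₁ x.1 * dirichletHom s₂ x.2)‖)
    {z : B ⊕ B → ℂ} (hz : ∀ i, ‖z i‖ ≤ 1) : k ≤ ‖bohrLift a S B z‖ := by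
  -- As `ρ ^ log p = p ^ log ρ`, the torus with parameter `ρ` corresponds to the line `Re s = -log
  -- ρ`, which lies in the half plane for `ρ ≤ 1`.
  let c : B → ℝ := fun p => Real.log (p : ℕ)
  have hc : ∀ p : B, 0 < c p := fun p => Real.log_pos (by exact_mod_cast (hB p p.2).one_lt)
  refine le_norm_of_forall_scaled_torus (differentiable_bohrLift a S B) (c := Sum.elim c c)
    (by rintro (p | p) <;> exact hc p) hk ?_ hz
  intro ρ hρ0 hρ1 w hw
  let G : (B → ℂ) × (B → ℂ) → ℂ := fun q => bohrLift a S B fun i =>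
    ((ρ ^ Sum.elim c c i : ℝ) : ℂ) * Sum.elim q.1 q.2 i
  have hG : Continuous G := by
    refine (differentiable_bohrLift a S B).continuous.comp (continuous_pi ?_)
    rintro (p | p)
    · exact continuous_const.mul ((continuous_apply p).comp continuous_fst)
    · exact continuous_const.mul ((continuous_apply p).comp continuous_snd)
  let R : Set (B → ℂ) := Set.range fun (t : ℝ) (p : B) => ((p : ℕ) : ℂ) ^ (-(t * Complex.I))
  -- The imaginary parts of `s₁` and `s₂` vary independently, so Kronecker's theorem is needed only
  -- in each factor separately.
  have hsub : closure (R ×ˢ R) ⊆ {q | k ≤ ‖G q‖} := by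
    refine closure_minimal ?_ (isClosed_le continuous_const hG.norm)
    rintro ⟨_, _⟩ ⟨⟨t₁, rfl⟩, ⟨t₂, rfl⟩⟩
    have hre : ∀ t : ℝ, 0 ≤ ((-Real.log ρ : ℝ) + t * Complex.I : ℂ).re := fun t => by
      simpa using Real.log_nonpos hρ0.le hρ1
    have hval : ∀ (t : ℝ) (p : B), ((ρ ^ c p : ℝ) : ℂ) * ((p : ℕ) : ℂ) ^ (-(t * Complex.I)) =
        dirichletHom ((-Real.log ρ : ℝ) + t * Complex.I) (primeToPNat hB p) := by
      intro t p
      have hp : ((p : ℕ) : ℂ) ≠ 0 := by exact_mod_cast (hB p p.2).ne_zero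
      rw [dirichletHom_apply, show ((primeToPNat hB p : ℕ+) : ℕ) = (p : ℕ) from rfl, Real.rpow_def_of_pos hρ0,
        Complex.ofReal_exp, Complex.cpow_def_of_ne_zero hp,
        Complex.cpow_def_of_ne_zero hp, ← Complex.exp_add, ← Complex.natCast_log]
      congr 1
      simp only [c]
      push_cast
      ring
    have := h _ _ (hre t₁) (hre t₂)
    rw [← bohrLift_apply hB a hS] at this
    simp only [Set.mem_ofPred_eq, G]
    convert this using 3
    funext i
    rcases i with p | p
    · exact hval t₁ p
    · exact hval t₂ p
  have hmem : ((fun p => w (.inl p), fun p => w (.inr p)) : (B → ℂ) × (B → ℂ)) ∈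
      closure (R ×ˢ R) := by
    rw [closure_prod_eq]
    exact ⟨prime_torus_subset_closure hB fun p => hw _, prime_torus_subset_closure hB fun p => hw _⟩
  have := hsub hmem
  simp only [Set.mem_ofPred_eq, G] at this
  convert this using 3
  funext i
  rcases i with p | p <;> rfl

end Primes

/-- The tail bound depends only on `b`, so one truncation serves all characters bounded by one. -/
theorem norm_tsum_sub_sum_le {b c : NSq → ℂ} (hb : Summable fun x => ‖b x‖)
    (hcb : ∀ x, ‖c x‖ ≤ ‖b x‖) (S : Finset NSq) :
    ‖∑' x, c x - ∑ x ∈ S, c x‖ ≤ ∑' x : {x // x ∉ S}, ‖b x‖ := by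
  have hc : Summable fun x => ‖c x‖ := Summable.of_nonneg_of_le (fun _ => norm_nonneg _) hcb hb
  rw [← hc.of_norm.sum_add_tsum_subtype_compl S, add_sub_cancel_left]
  exact (norm_tsum_le_tsum_norm (hc.subtype _)).trans
    ((hc.subtype _).tsum_le_tsum (fun x => hcb x) (hb.subtype _))

/-- A lower bound for an absolutely convergent double Dirichlet series on the closed half planes
is a lower bound for the series at every bounded character of `ℕ²`. -/
theorem HasDirichletSeries.le_norm_tsum {f : ClosedRightHalfPlane × ClosedRightHalfPlane → ℂ}
    {a : NSq → ℂ} (hf : HasDirichletSeries f a) (ha : Summable fun x => ‖a x‖) {k : ℝ}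
    (hk : ∀ s, k ≤ ‖f s‖) (χ : NSq →* ℂ) (hχ : ∀ x, ‖χ x‖ ≤ 1) :
    k ≤ ‖∑' x, a x * χ x‖ := by
  classical
  refine le_of_forall_pos_le_add fun ε hε => ?_
  by_cases hkε : k ≤ ε
  -- For `k > ε` the truncated bound `k - ε / 2` stays positive, as the minimum principle requires.
  · exact hkε.trans (le_add_of_nonneg_left (norm_nonneg _))
  push Not at hkε
  obtain ⟨S, hS⟩ := ((tendsto_order.1 (tendsto_tsum_compl_atTop_zero fun x => ‖a x‖)).2
    (ε / 2) (half_pos hε)).exists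
  let B : Finset ℕ := S.biUnion fun x => (x.1 : ℕ).primeFactors ∪ (x.2 : ℕ).primeFactors
  have hB : ∀ p ∈ B, p.Prime := by
    intro p hp
    obtain ⟨x, _, hx⟩ := Finset.mem_biUnion.1 hp
    rcases Finset.mem_union.1 hx with h | h <;> exact Nat.prime_of_mem_primeFactors h
  have hSB : ∀ x ∈ S, (x.1 : ℕ).primeFactors ⊆ B ∧ (x.2 : ℕ).primeFactors ⊆ B := fun x hx =>
    ⟨Finset.subset_union_left.trans (Finset.subset_biUnion_of_mem
      (fun x : NSq => (x.1 : ℕ).primeFactors ∪ (x.2 : ℕ).primeFactors) hx),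
    Finset.subset_union_right.trans (Finset.subset_biUnion_of_mem
      (fun x : NSq => (x.1 : ℕ).primeFactors ∪ (x.2 : ℕ).primeFactors) hx)⟩
  have hpoly : ∀ s₁ s₂ : ℂ, 0 ≤ s₁.re → 0 ≤ s₂.re →
      k - ε / 2 ≤ ‖∑ x ∈ S, a x * (dirichletHom s₁ x.1 * dirichletHom s₂ x.2)‖ := by
    intro s₁ s₂ h₁ h₂
    have h1 := hk (⟨s₁, h₁⟩, ⟨s₂, h₂⟩)
    rw [← (hf.hasSum (⟨s₁, h₁⟩, ⟨s₂, h₂⟩)).tsum_eq] at h1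
    have h2 := norm_tsum_sub_sum_le ha (norm_mul_dirichletHom_le a h₁ h₂) S
    have h3 := norm_sub_norm_le (∑' x : NSq, a x * (dirichletHom s₁ x.1 * dirichletHom s₂ x.2))
      (∑ x ∈ S, a x * (dirichletHom s₁ x.1 * dirichletHom s₂ x.2))
    simp only at h1
    linarith
  let ψ₁ : ℕ+ →* ℂ := χ.comp (MonoidHom.inl ℕ+ ℕ+)
  let ψ₂ : ℕ+ →* ℂ := χ.comp (MonoidHom.inr ℕ+ ℕ+)
  have hψ : ∀ x : NSq, χ x = ψ₁ x.1 * ψ₂ x.2 := by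
    intro x
    change χ x = χ (x.1, 1) * χ (1, x.2)
    rw [← map_mul]
    simp
  have h1 := le_norm_bohrLift hB hSB (sub_pos.2 (by linarith)) hpoly
    (z := Sum.elim (fun p => ψ₁ (primeToPNat hB p)) fun p => ψ₂ (primeToPNat hB p))
    (by rintro (p | p) <;> exact hχ _)
  rw [bohrLift_apply hB a hSB] at h1
  simp only [← hψ] at h1
  have h2 := norm_tsum_sub_sum_le (c := fun x => a x * χ x) ha (fun x => by
    rw [norm_mul]; exact mul_le_of_le_one_right (norm_nonneg _) (hχ x)) S
  have h3 := norm_sub_norm_le (∑ x ∈ S, a x * χ x) (∑' x, a x * χ x)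
  rw [norm_sub_rev] at h3
  linarith

/-! ### Gelfand theory and the equivalence -/

/-- A nonnegative number whose powers grow at most like an admissible weight is at most one. -/
theorem IsAdmissibleWeight.le_one_of_pow_le (hω : IsAdmissibleWeight ω) (x : NSq) {r C : ℝ}
    (hr : 0 ≤ r) (hC : 0 < C) (h : ∀ n : ℕ, r ^ n ≤ ω (x ^ n) * C) : r ≤ 1 := by
  have hC1 : Tendsto (fun n : ℕ => C ^ (1 / (n : ℝ))) atTop (𝓝 1) := by
    have := (Real.continuous_const_rpow hC.ne').tendsto 0 |>.comp
      (tendsto_one_div_atTop_nhds_zero_nat (𝕜 := ℝ))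
    simpa [Function.comp_def] using this
  have hlim := (hω.tendsto_one x.1 x.2).mul hC1
  rw [one_mul] at hlim
  refine ge_of_tendsto hlim ?_
  filter_upwards [eventually_ne_atTop 0] with n hn
  have hω0 : 0 ≤ ω (x ^ n) := zero_le_one.trans (hω.one_le _)
  have := Real.rpow_le_rpow (pow_nonneg hr n) (h n) (z := 1 / (n : ℝ)) (by positivity)
  rw [one_div, Real.pow_rpow_inv_natCast hr hn, Real.mul_rpow hω0 hC.le] at this
  simpa only [one_div, Prod.pow_def] using this

theorem hasInverseInWeightedL1_of_boundedAwayFromZero (hω : IsAdmissibleWeight ω)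
    {f : ClosedRightHalfPlane × ClosedRightHalfPlane → ℂ} {a : NSq → ℂ}
    (ha : a ∈ weightedL1 ω) (hf : HasDirichletSeries f a) (h : BoundedAwayFromZero f) :
    HasInverseInWeightedL1 ω a := by
  obtain ⟨k, hk, hkf⟩ := h
  have hw := hω.toIsWeight
  let α : weightedL1Algebra hw := ⟨a, ha⟩
  suffices hu : IsUnit α by
    obtain ⟨β, hβ⟩ := hu.exists_right_inv
    exact ⟨β.1.coeff, β.2, congrArg (fun γ : weightedL1Algebra hw => γ.1.coeff) hβ⟩
  by_contra hu
  obtain ⟨φ, hφ⟩ := WeakDual.CharacterSpace.exists_apply_eq_zero hu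
  let χ : NSq →* ℂ :=
    { toFun := fun x => φ (weightedL1Algebra.single hw x)
      map_one' := by rw [weightedL1Algebra.single_one, map_one]
      map_mul' := fun x y => by rw [weightedL1Algebra.single_mul, map_mul] }
  have hχ : ∀ x, ‖χ x‖ ≤ 1 := by
    intro x
    -- The unit has norm `ω 1`, possibly larger than one, hence the extra constant; it disappears on
    -- taking `n`-th roots.
    refine hω.le_one_of_pow_le x (norm_nonneg _) (C := ‖(1 : weightedL1Algebra hw)‖) ?_ ?_
    · rw [← weightedL1Algebra.single_one, weightedL1Algebra.norm_single]
      exact zero_lt_one.trans_le (hw.one_le 1)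
    · intro n
      rw [← norm_pow, ← map_pow, ← weightedL1Algebra.norm_single hw]
      exact spectrum.norm_le_norm_mul_of_mem (AlgHom.apply_mem_spectrum φ _)
  have hsum : HasSum (fun x => a x * χ x) 0 := by
    have := (weightedL1Algebra.hasSum_single hw α).map φ (map_continuous φ)
    rw [hφ] at this
    convert this with x
    exact (map_smul φ (a x) (weightedL1Algebra.single hw x)).symm
  have := hf.le_norm_tsum (hw.summable_norm ha) hkf χ hχ
  rw [hsum.tsum_eq, norm_zero] at this
  exact absurd this (not_le.2 hk)

theorem hasInverseInDirichletAlgebra_of_hasInverseInWeightedL1 (hω : IsWeight ω)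
    {f : ClosedRightHalfPlane × ClosedRightHalfPlane → ℂ} {a : NSq → ℂ}
    (ha : a ∈ weightedL1 ω) (hf : HasDirichletSeries f a) (h : HasInverseInWeightedL1 ω a) :
    HasInverseInDirichletAlgebra ω f := by
  obtain ⟨b, hb, hab⟩ := h
  have hs : ∀ (s : ClosedRightHalfPlane × ClosedRightHalfPlane) {c : NSq → ℂ}, c ∈ weightedL1 ω →
      Summable fun x : NSq => ‖c x * (dirichletHom s.1 x.1 * dirichletHom s.2 x.2)‖ :=
    fun s c hc => Summable.of_nonneg_of_le (fun _ => norm_nonneg _)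
      (norm_mul_dirichletHom_le c s.1.2 s.2.2) (hω.summable_norm hc)
  refine ⟨fun s => ∑' x : NSq, b x * (dirichletHom s.1 x.1 * dirichletHom s.2 x.2),
    ⟨b, hb, fun s₁ s₂ => ?_⟩, ?_⟩
  · simpa only [dirichletHom_apply, mul_assoc] using (hs (s₁, s₂) hb).of_norm.hasSum
  · funext s
    have h := hasSum_convolution (χ := fun x : NSq => dirichletHom s.1 x.1 * dirichletHom s.2 x.2)
      (fun x y => by simp only [Prod.fst_mul, Prod.snd_mul, map_mul]; ring) (hs s ha) (hs s hb)
    rw [(hf.hasSum s).tsum_eq, hab] at h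
    refine h.unique ?_
    rw [Pi.one_apply]
    convert hasSum_ite_eq (1 : NSq) (1 : ℂ) with x
    by_cases hx : x = 1 <;> simp [convolutionOne, hx]

theorem boundedAwayFromZero_of_hasInverseInDirichletAlgebra (hω : IsWeight ω)
    {f : ClosedRightHalfPlane × ClosedRightHalfPlane → ℂ}
    (h : HasInverseInDirichletAlgebra ω f) : BoundedAwayFromZero f := by
  obtain ⟨g, ⟨b, hb, hg⟩, hfg⟩ := h
  have hbs := hω.summable_norm hb
  have hgle : ∀ s, ‖g s‖ ≤ ∑' x, ‖b x‖ := by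
    intro s
    rw [← (hg.hasSum s).tsum_eq]
    exact tsum_of_norm_bounded hbs.hasSum (norm_mul_dirichletHom_le b s.1.2 s.2.2)
  have hpos : 0 < 1 + ∑' x, ‖b x‖ := by
    have : 0 ≤ ∑' x, ‖b x‖ := tsum_nonneg fun x => norm_nonneg (b x)
    linarith
  -- The added `1` makes the bound on `g` positive without showing `b ≠ 0`.
  refine ⟨(1 + ∑' x, ‖b x‖)⁻¹, inv_pos.2 hpos, fun s => ?_⟩
  have h1 : ‖f s‖ * ‖g s‖ = 1 := by
    rw [← norm_mul, ← Pi.mul_apply, hfg]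
    simp
  rw [inv_le_iff_one_le_mul₀ hpos, ← h1]
  exact mul_le_mul_of_nonneg_left ((hgle s).trans (by linarith)) (norm_nonneg _)

theorem proposition2 (ω : NSq → ℝ) (hω : IsAdmissibleWeight ω)
    (f : ClosedRightHalfPlane × ClosedRightHalfPlane → ℂ) (a : NSq → ℂ)
    (ha : a ∈ weightedL1 ω) (hf : HasDirichletSeries f a) :
    List.TFAE
      [HasInverseInWeightedL1 ω a,
       BoundedAwayFromZero f,
       HasInverseInDirichletAlgebra ω f] := by
  tfae_have 1 → 3 := hasInverseInDirichletAlgebra_of_hasInverseInWeightedL1 hω.toIsWeight ha hf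
  tfae_have 3 → 2 := boundedAwayFromZero_of_hasInverseInDirichletAlgebra hω.toIsWeight
  tfae_have 2 → 1 := hasInverseInWeightedL1_of_boundedAwayFromZero hω ha hf
  tfae_finish
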